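/- Let $A$ be an arbitrary (not necessarily unital) $C^*$-algebra and $X$ a right Hilbert $C^*$-module over $A$, with $A$-valued inner product $\langle\cdot,\cdot\rangle$, linear in the second variable. Let $\ell^2(A)$ be the Hilbert $A$-module of all sequences $(a_n)_{n\ge1}$ in $A$ for which $\sum_n a_n^*a_n$ converges in norm, with $\langle (a_n)_n,(b_n)_n\rangle=\sum_n a_n^*b_n$. For Hilbert modules $Y,Z$ let $\mathbb B(Y,Z)$ be the space of adjointable operators from $Y$ to $Z$, let $\theta_{y,x}$ denote the operator $z\mapsto y\langle x,z\rangle$, and let $\mathbb F(Y)$ be the linear span of $\{\theta_{y,x}:x,y\in Y\}$. Let $M(A)=\mathbb B(A,A)$ be the multiplier algebra of $A$ and $M(X)=\mathbb B(A,X)$ the multiplier module of $X$, a Hilbert $M(A)$-module with inner product $\langle v,w\rangle=v^*w$. It contains $X$, where $x\in X$ is identified with the operator $a\mapsto xa$; if $v\in M(X)$ and $x\in X$, then $\langle v,x\rangle=v^*(x)\in A$. A sequence $(v_n)_{n\ge1}$ in $X$ is a frame for $X$ if there are constants $C,D>0$ such that, for all $x\in X$, the series below converges in norm and $$C\langle x,x\rangle\le\sum_{n=1}^\infty\langle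 x,v_n\rangle\langle v_n,x\rangle\le D\langle x,x\rangle ;$$ it is a Bessel sequence if this holds with only the second inequality required. A sequence $(v_n)_{n\ge1}$ in $M(X)$ with $v_n\in M(X)\setminus X$ for at least one $n$ is an outer frame for $X$, respectively an outer Bessel sequence, if the same condition holds (for all $x\in X$). The analysis operator of a Bessel or outer Bessel sequence $(v_n)_n$ is $U:X\to\ell^2(A)$, $Ux=(\langle v_n,x\rangle)_n$. A finite extension of a sequence $(x_n)_{n\ge1}$ is a sequence $f_1,\dots,f_N,x_1,x_2,\dots$ obtained by adding finitely many (possibly no) elements $f_i\in M(X)$. **Theorem.** (a) Let $(x_n)_{n=1}^\infty$ be a Bessel or an outer Bessel sequence for $X$ with analysis operator $U$. Then $(x_n)_n$ has a finite extension that is a frame or an outer frame for $X$ if and only if there exist $V\in\mathbb B(X,\ell^2(A))$ and $\theta\in\mathbb F(M(X))$ such that $I-V^*U=\theta|_X$. (b) Let $(x_n)_{n=1}^\infty$ be a Bessel sequence in $X$ with analysis operator $U$. Then $(x_n)_n$ has a finite extension by elements $f_1,\dots,f_N\in X$ that is a frame for $X$ if and only if there exists $V\in\mathbb B(X,\ell^2(A))$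 such that $I-V^*U\in\mathbb F(X)$. -/

import Mathlib

set_option linter.unusedSectionVars false
set_option linter.unnecessarySeqFocus false

open Filter Topology MulOpposite

noncomputable section

namespace ModFrame

/-! ### Right Hilbert modules

Mathlib's class `CStarModule B E` uses the action `b • x` with `⟪x, b • y⟫ = b * ⟪x, y⟫`. A right
Hilbert module over `A`, with `⟪x, y a⟫ = ⟪x, y⟫ a`, is therefore the same as a
`CStarModule Aᵐᵒᵖ E`, where `x a` is written `op a • x`. -/

section Basics

variable (A : Type*) {X : Type*} [NonUnitalCStarAlgebra A] [PartialOrder A] [StarOrderedRing A]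
  [NormedAddCommGroup X] [NormedSpace ℂ X] [SMul Aᵐᵒᵖ X] [CStarModule Aᵐᵒᵖ X]

/-- The `A`-valued inner product of a right Hilbert `A`-module. -/
def rinner (x y : X) : A := unop (inner Aᵐᵒᵖ x y)

lemma rinner_smul_right (x y : X) (a : A) : rinner A x (op a • y) = rinner A x y * a := by
  simp [rinner]

lemma star_rinner (x y : X) : star (rinner A x y) = rinner A y x := by
  simp only [rinner, ← unop_star, CStarModule.star_inner]

lemma rinner_add_right (x y z : X) : rinner A x (y + z) = rinner A x y + rinner A x z := by
  simp [rinner]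

lemma rinner_smul_complex (x y : X) (c : ℂ) : rinner A x (c • y) = c • rinner A x y := by
  simp [rinner]

lemma rinner_add_left (x y z : X) : rinner A (x + y) z = rinner A x z + rinner A y z := by
  simp [rinner]

lemma rinner_smul_complex_left (x y : X) (c : ℂ) :
    rinner A (c • x) y = star c • rinner A x y := by
  simp [rinner]

lemma rinner_smul_left (x y : X) (a : A) : rinner A (op a • x) y = star a * rinner A x y := by
  rw [← star_rinner, rinner_smul_right, star_mul, star_rinner]

variable {A} in
lemma ext_rinner {x y : X} (h : ∀ z : X, rinner A z x = rinner A z y) : x = y := by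
  rw [← sub_eq_zero, ← CStarModule.inner_self (A := Aᵐᵒᵖ)]
  have := h (x - y)
  simp only [rinner, unop_inj] at this
  rw [CStarModule.inner_sub_right, this, sub_self]

lemma norm_sq_rinner (x : X) : ‖x‖ ^ 2 = ‖rinner A x x‖ := by
  rw [CStarModule.norm_sq_eq Aᵐᵒᵖ, rinner, norm_unop]

lemma norm_right_smul_le (x : X) (a : A) : ‖op a • x‖ ≤ ‖x‖ * ‖a‖ := by
  refine (pow_le_pow_iff_left₀ (norm_nonneg _) (by positivity) two_ne_zero).mp ?_
  rw [norm_sq_rinner A, rinner_smul_right, rinner_smul_left, mul_pow, norm_sq_rinner A x]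
  calc ‖star a * rinner A x x * a‖ ≤ ‖star a‖ * ‖rinner A x x‖ * ‖a‖ :=
        (norm_mul_le _ _).trans (by gcongr; exact norm_mul_le _ _)
    _ = ‖rinner A x x‖ * ‖a‖ ^ 2 := by rw [norm_star]; ring

/-- The complex-linear map `a ↦ x a`. -/
def rightMulCLM (x : X) : A →L[ℂ] X :=
  LinearMap.mkContinuous
    { toFun := fun a => op a • x
      map_add' := fun a b => ext_rinner (A := A) fun z => by
        simp only [rinner_smul_right, rinner_add_right, mul_add]
      map_smul' := fun c a => ext_rinner (A := A) fun z => by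
        simp only [rinner_smul_right, rinner_smul_complex, mul_smul_comm, RingHom.id_apply] }
    ‖x‖ (norm_right_smul_le A x)

/-- The complex-linear map `y ↦ ⟪x, y⟫`. -/
def rinnerCLM (x : X) : X →L[ℂ] A :=
  LinearMap.mkContinuous
    { toFun := fun y => rinner A x y
      map_add' := rinner_add_right A x
      map_smul' := fun c y => rinner_smul_complex A x y c }
    ‖x‖ (fun y => by
      have := CStarModule.norm_inner_le (A := Aᵐᵒᵖ) X (x := x) (y := y)
      rwa [← norm_unop] at this)

/-- The C*-algebra `A` as a right Hilbert module over itself, with `⟪a, b⟫ = a* b`. -/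
instance instSelf : CStarModule Aᵐᵒᵖ A where
  inner a b := op (star a * b)
  inner_add_right := by simp [mul_add]
  inner_self_nonneg {a} := star_mul_self_nonneg a
  inner_self {a} := by
    rw [op_eq_zero_iff]
    exact CStarRing.star_mul_self_eq_zero_iff a
  inner_op_smul_right {c a b} := by
    rw [← op_unop c, ← op_mul]
    simp [mul_assoc]
  inner_smul_right_complex := by simp [mul_smul_comm]
  star_inner a b := by rw [← op_star]; simp
  norm_eq_sqrt_norm_inner_self a := by
    rw [norm_op, CStarRing.norm_star_mul_self, Real.sqrt_mul_self (norm_nonneg _)]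

lemma rinner_self_def (a b : A) : rinner A a b = star a * b := rfl

end Basics

/-! ### Adjointable operators -/

section Adjointable

variable (A : Type*) (X Y : Type*) [NonUnitalCStarAlgebra A] [PartialOrder A] [StarOrderedRing A]
  [NormedAddCommGroup X] [NormedSpace ℂ X] [SMul Aᵐᵒᵖ X] [CStarModule Aᵐᵒᵖ X]
  [NormedAddCommGroup Y] [NormedSpace ℂ Y] [SMul Aᵐᵒᵖ Y] [CStarModule Aᵐᵒᵖ Y]

/-- The normed space `𝔹(X, Y)` of adjointable operators between two right Hilbert `A`-modules, with
the operator norm. Such operators are automatically `A`-linear. -/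
def BOp : Submodule ℂ (X →L[ℂ] Y) where
  carrier := {T | ∃ S : Y →L[ℂ] X, ∀ x y, rinner A (T x) y = rinner A x (S y)}
  add_mem' := by
    rintro T T' ⟨S, hS⟩ ⟨S', hS'⟩
    exact ⟨S + S', fun x y => by simp [rinner_add_left, rinner_add_right, hS, hS']⟩
  zero_mem' := ⟨0, fun x y => by simp [rinner]⟩
  smul_mem' := by
    rintro c T ⟨S, hS⟩
    exact ⟨star c • S, fun x y => by
      simp only [smul_apply, rinner_smul_complex_left, rinner_smul_complex, hS]⟩

variable {A X Y}

/-- The adjoint `T*` of an adjointable operator, characterised by `⟪T x, y⟫ = ⟪x, T* y⟫`. -/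
def adj (T : BOp A X Y) : BOp A Y X :=
  ⟨T.2.choose, T.1, fun y x => by
    rw [← star_rinner, ← T.2.choose_spec x y, star_rinner]⟩

lemma rinner_adj (T : BOp A X Y) (x : X) (y : Y) :
    rinner A (T.1 x) y = rinner A x ((adj T).1 y) := T.2.choose_spec x y

/-- The adjoint is the only map satisfying the adjoint relation. -/
lemma eq_adj (T : BOp A X Y) {x : X} {y : Y}
    (h : ∀ z, rinner A (T.1 z) y = rinner A z x) : (adj T).1 y = x :=
  ext_rinner (A := A) fun z => by rw [← rinner_adj T, h]

/-- Composition of adjointable operators. -/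
def comp {Z : Type*} [NormedAddCommGroup Z] [NormedSpace ℂ Z] [SMul Aᵐᵒᵖ Z]
    [CStarModule Aᵐᵒᵖ Z] (S : BOp A Y Z) (T : BOp A X Y) : BOp A X Z :=
  ⟨S.1.comp T.1, (adj T).1.comp (adj S).1, fun x z => by
    simp [rinner_adj]⟩

/-- The operator `θ_{y,x} : z ↦ y ⟪x, z⟫` from `X` to `Y`. -/
def theta (y : Y) (x : X) : X →ₗ[ℂ] Y :=
  ((rightMulCLM A y).comp (rinnerCLM A x)).toLinearMap

lemma theta_apply (y : Y) (x z : X) : theta (A := A) y x z = op (rinner A x z) • y := rfl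

variable (A X) in
/-- The space `𝔽(X)` of "finite rank" operators, i.e. the linear span of all `θ_{y,x}`. -/
def FinRank : Submodule ℂ (X →ₗ[ℂ] X) :=
  Submodule.span ℂ (Set.range fun p : X × X => theta (A := A) p.1 p.2)

end Adjointable

/-! ### The multiplier module -/

section Multiplier

variable (A : Type*) (X : Type*) [NonUnitalCStarAlgebra A] [PartialOrder A] [StarOrderedRing A]
  [NormedAddCommGroup X] [NormedSpace ℂ X] [SMul Aᵐᵒᵖ X] [CStarModule Aᵐᵒᵖ X]

/-- The multiplier module `M(X) = 𝔹(A, X)`. For `X = A` this is the multiplier algebra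
`M(A) = 𝔹(A, A)`, whose product is composition. -/
abbrev MulMod := BOp A A X

variable {A X}

/-- The right action of `M(A)` on `M(X)`: `v m = v ∘ m`. -/
def act (v : MulMod A X) (m : MulMod A A) : MulMod A X := comp v m

/-- The `M(A)`-valued inner product on `M(X)`: `⟪v, w⟫ = v* ∘ w`. -/
def minner (v w : MulMod A X) : MulMod A A := comp (adj v) w

variable (A) in
/-- The inclusion `X ⊆ M(X)`, where `x : X` is identified with the operator `a ↦ x a`. -/
def emb : X →ₗ[ℂ] MulMod A X where
  toFun x := ⟨rightMulCLM A x, rinnerCLM A x, fun a y => by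
    change rinner A (op a • x) y = star a * rinner A x y
    exact rinner_smul_left A x y a⟩
  map_add' x y := Subtype.ext <| ContinuousLinearMap.ext fun a => ext_rinner (A := A) fun z => by
    change rinner A z (op a • (x + y)) = rinner A z (op a • x + op a • y)
    simp only [rinner_add_right, rinner_smul_right, add_mul]
  map_smul' c x := Subtype.ext <| ContinuousLinearMap.ext fun a => ext_rinner (A := A) fun z => by
    change rinner A z (op a • (c • x)) = rinner A z (c • (op a • x))
    simp only [rinner_smul_right, rinner_smul_complex, smul_mul_assoc]

/-- For `v : M(X)` and `x : X`, the inner product `⟪v, x⟫`, which is an element of `A`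
(see `minner_emb`). -/
def pair (v : MulMod A X) (x : X) : A := (adj v).1 x

/-- Under `A ⊆ M(A)` and `X ⊆ M(X)`, `pair` is the inner product of `M(X)`. -/
lemma minner_emb (v : MulMod A X) (x : X) : minner v (emb A x) = emb A (pair v x) := by
  refine Subtype.ext <| ContinuousLinearMap.ext fun a => ?_
  change (adj v).1 (op a • x) = op a • (adj v).1 x
  refine eq_adj v fun z => ?_
  rw [rinner_smul_right, rinner_smul_right, rinner_adj v]

/-- On `X`, `pair` is the inner product of `X`. -/
lemma pair_emb (x y : X) : pair (emb A x) y = rinner A x y := by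
  refine eq_adj (A := A) _ fun a => ?_
  change rinner A (op a • x) y = star a * rinner A x y
  exact rinner_smul_left A x y a

/-- The operator `θ_{v,w} : z ↦ v ⟪w, z⟫` on `M(X)`. -/
def mtheta (v w : MulMod A X) : MulMod A X →ₗ[ℂ] MulMod A X where
  toFun z := act v (minner w z)
  map_add' z z' := Subtype.ext <| ContinuousLinearMap.ext fun a => by
    simp [act, minner, comp]
  map_smul' c z := Subtype.ext <| ContinuousLinearMap.ext fun a => by
    simp [act, minner, comp]

variable (A X) in
/-- The space `𝔽(M(X))` of "finite rank" operators on the Hilbert `M(A)`-module `M(X)`. -/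
def MFinRank : Submodule ℂ (MulMod A X →ₗ[ℂ] MulMod A X) :=
  Submodule.span ℂ (Set.range fun p : MulMod A X × MulMod A X => mtheta p.1 p.2)

end Multiplier

/-! ### The generalized Hilbert space -/

section L2

variable (A : Type*) [NonUnitalCStarAlgebra A] [PartialOrder A] [StarOrderedRing A]

variable {A} in
/-- A series of positive elements of a C*-algebra converges in norm if and only if it is summable
(unconditionally), so that `Summable` and `HasSum` below express norm convergence of series. -/
lemma summable_iff_of_nonneg {f : ℕ → A} (hf : ∀ n, 0 ≤ f n) :
    Summable f ↔ ∃ s, Tendsto (fun N => ∑ n ∈ Finset.range N, f n) atTop (𝓝 s) := by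
  refine ⟨fun h => ⟨_, h.hasSum.tendsto_sum_nat⟩, fun ⟨s, hs⟩ => ?_⟩
  rw [summable_iff_vanishing_norm]
  intro ε hε
  obtain ⟨N, hN⟩ := Metric.cauchySeq_iff.mp hs.cauchySeq ε hε
  refine ⟨Finset.range N, fun t ht => ?_⟩
  obtain ⟨M, hM⟩ := t.exists_nat_subset_range
  have h1 : t ⊆ Finset.range (max M N) \ Finset.range N := fun i hi => by
    have := Finset.disjoint_left.mp ht hi
    have := Finset.mem_range.mp (hM hi)
    simp_all
  have h2 := hN (max M N) (le_max_right _ _) N le_rfl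
  rw [dist_eq_norm, ← Finset.sum_sdiff_eq_sub (Finset.range_mono (le_max_right M N))] at h2
  refine lt_of_le_of_lt ?_ h2
  exact CStarAlgebra.norm_le_norm_of_nonneg_of_le (Finset.sum_nonneg fun i _ => hf i)
    (Finset.sum_le_sum_of_subset_of_nonneg h1 fun i _ _ => hf i)

variable {A} in
lemma summable_of_nonneg_of_le {f g : ℕ → A} (hf : ∀ n, 0 ≤ f n) (hfg : ∀ n, f n ≤ g n)
    (hg : Summable g) : Summable f := by
  rw [summable_iff_vanishing_norm] at hg ⊢
  intro ε hε
  obtain ⟨s, hs⟩ := hg ε hε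
  refine ⟨s, fun t ht => lt_of_le_of_lt ?_ (hs t ht)⟩
  exact CStarAlgebra.norm_le_norm_of_nonneg_of_le (Finset.sum_nonneg fun i _ => hf i)
    (Finset.sum_le_sum fun i _ => hfg i)

/-- The space of sequences `(aₙ)` in `A` for which `∑ aₙ* aₙ` converges in norm. -/
def l2Submodule : Submodule ℂ (ℕ → A) where
  carrier := {a | Summable fun n => star (a n) * a n}
  add_mem' := by
    intro a b ha hb
    refine summable_of_nonneg_of_le (fun n => star_mul_self_nonneg _) (fun n => ?_)
      ((ha.add hb).const_smul (2 : ℂ))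
    have h := star_mul_self_nonneg (a n - b n)
    rw [← sub_nonneg]
    refine h.trans_eq ?_
    simp only [Pi.add_apply, star_add, star_sub, mul_add, mul_sub, add_mul, sub_mul, two_smul]
    abel
  zero_mem' := by simp
  smul_mem' := by
    intro c a ha
    refine (Summable.const_smul (star c * c) ha).congr fun n => ?_
    simp only [Pi.smul_apply, star_smul, smul_mul_assoc, mul_smul_comm, smul_smul, mul_comm]

/-- The generalized Hilbert space `ℓ²(A)`. -/
def L2 : Type _ := l2Submodule A

namespace L2

instance : AddCommGroup (L2 A) := inferInstanceAs (AddCommGroup (l2Submodule A))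

instance : Module ℂ (L2 A) := inferInstanceAs (Module ℂ (l2Submodule A))

variable {A}

/-- The `n`-th term of an element of `ℓ²(A)`. -/
def coord (a : L2 A) (n : ℕ) : A := a.1 n

lemma ext {a b : L2 A} (h : ∀ n, a.coord n = b.coord n) : a = b := Subtype.ext (funext h)

lemma coord_add (a b : L2 A) (n : ℕ) : (a + b).coord n = a.coord n + b.coord n := rfl

lemma coord_smul (c : ℂ) (a : L2 A) (n : ℕ) : (c • a).coord n = c • a.coord n := rfl

lemma coord_zero (n : ℕ) : (0 : L2 A).coord n = 0 := rfl

lemma summable_self (a : L2 A) : Summable fun n => star (a.coord n) * a.coord n := a.2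

lemma summable (a b : L2 A) : Summable fun n => star (a.coord n) * b.coord n := by
  have h := ((((a + b).summable_self.sub (a + (-1 : ℂ) • b).summable_self).sub
    ((a + Complex.I • b).summable_self.const_smul Complex.I)).add
    ((a + (-Complex.I) • b).summable_self.const_smul Complex.I)).const_smul (1 / 4 : ℂ)
  refine h.congr fun n => ?_
  simp only [coord_add, coord_smul, star_add, star_smul, mul_add, add_mul, smul_add, smul_sub,
    smul_mul_assoc, mul_smul_comm, smul_smul]
  generalize star (a.coord n) * a.coord n = p
  generalize star (a.coord n) * b.coord n = q
  generalize star (b.coord n) * a.coord n = r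
  generalize star (b.coord n) * b.coord n = t
  simp only [Complex.star_def, Complex.conj_I, map_neg, map_one]
  match_scalars <;> ring_nf <;> simp <;> ring_nf

/-- The right action of `A`: `(aₙ) c = (aₙ c)`. -/
instance : SMul Aᵐᵒᵖ (L2 A) where
  smul c a := ⟨fun n => a.coord n * unop c, by
    change Summable fun n => star (a.coord n * unop c) * (a.coord n * unop c)
    refine ((a.summable_self.mul_left (star (unop c))).mul_right (unop c)).congr fun n => ?_
    simp [mul_assoc]⟩

lemma coord_act (c : Aᵐᵒᵖ) (a : L2 A) (n : ℕ) : (c • a).coord n = a.coord n * unop c := rfl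

instance : Norm (L2 A) where
  norm a := √‖∑' n, star (a.coord n) * a.coord n‖

/-- The inner product of `ℓ²(A)` is `⟪(aₙ), (bₙ)⟫ = ∑ aₙ* bₙ`. -/
instance : CStarModule Aᵐᵒᵖ (L2 A) where
  inner a b := op (∑' n, star (a.coord n) * b.coord n)
  inner_add_right {a b c} := by
    rw [← op_add, ← (summable a b).tsum_add (summable a c)]
    simp only [coord_add, mul_add]
  inner_self_nonneg {a} := tsum_nonneg fun n => star_mul_self_nonneg (a.coord n)
  inner_self {a} := by
    rw [op_eq_zero_iff]
    constructor
    · intro h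
      have h0 := a.summable_self.hasSum
      rw [h] at h0
      refine ext fun n => ?_
      have h1 : star (a.coord n) * a.coord n ≤ 0 :=
        le_hasSum h0 n fun j _ => star_mul_self_nonneg _
      exact (CStarRing.star_mul_self_eq_zero_iff _).mp (le_antisymm h1 (star_mul_self_nonneg _))
    · rintro rfl
      simp [coord_zero]
  inner_op_smul_right {c a b} := by
    rw [← op_unop c, ← op_mul, ← (summable a b).tsum_mul_right]
    simp only [coord_act, mul_assoc, unop_op]
  inner_smul_right_complex {c a b} := by
    rw [← op_smul, ← (summable a b).tsum_const_smul]
    simp only [coord_smul, mul_smul_comm]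
  star_inner a b := by
    rw [← op_star, tsum_star]
    simp only [star_mul, star_star]
  norm_eq_sqrt_norm_inner_self a := by rw [norm_op]; rfl

instance : NormedAddCommGroup (L2 A) := .ofCore (CStarModule.normedSpaceCore Aᵐᵒᵖ)

instance : NormedSpace ℂ (L2 A) := .ofCore (CStarModule.normedSpaceCore Aᵐᵒᵖ)

lemma rinner_def (a b : L2 A) : rinner A a b = ∑' n, star (a.coord n) * b.coord n := rfl

end L2

end L2

/-! ### Frames, outer frames and Bessel sequences -/

section Frames

variable (A : Type*) {X : Type*} [NonUnitalCStarAlgebra A] [PartialOrder A] [StarOrderedRing A]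
  [NormedAddCommGroup X] [NormedSpace ℂ X] [SMul Aᵐᵒᵖ X] [CStarModule Aᵐᵒᵖ X]

/-- A sequence in `X` is a frame for `X`. -/
def IsFrame (x : ℕ → X) : Prop :=
  ∃ C D : ℝ, 0 < C ∧ 0 < D ∧ ∀ y : X, ∃ s : A,
    HasSum (fun n => rinner A y (x n) * rinner A (x n) y) s ∧
    C • rinner A y y ≤ s ∧ s ≤ D • rinner A y y

/-- A sequence in `X` is a Bessel sequence. -/
def IsBessel (x : ℕ → X) : Prop :=
  ∃ D : ℝ, 0 < D ∧ ∀ y : X, ∃ s : A,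
    HasSum (fun n => rinner A y (x n) * rinner A (x n) y) s ∧ s ≤ D • rinner A y y

variable {A}

/-- A sequence in `M(X)` is an outer frame for `X`: some term lies outside `X`, and the frame
inequalities hold on `X` (where `⟪y, vₙ⟫ = ⟪vₙ, y⟫*`). -/
def IsOuterFrame (v : ℕ → MulMod A X) : Prop :=
  (∃ n, v n ∉ Set.range (emb A (X := X))) ∧
  ∃ C D : ℝ, 0 < C ∧ 0 < D ∧ ∀ y : X, ∃ s : A,
    HasSum (fun n => star (pair (v n) y) * pair (v n) y) s ∧
    C • rinner A y y ≤ s ∧ s ≤ D • rinner A y y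

/-- A sequence in `M(X)` is an outer Bessel sequence. -/
def IsOuterBessel (v : ℕ → MulMod A X) : Prop :=
  (∃ n, v n ∉ Set.range (emb A (X := X))) ∧
  ∃ D : ℝ, 0 < D ∧ ∀ y : X, ∃ s : A,
    HasSum (fun n => star (pair (v n) y) * pair (v n) y) s ∧ s ≤ D • rinner A y y

/-- The sequence `v` is a frame for `X` (so all its terms lie in `X`) or an outer frame for `X`. -/
def IsFrameOrOuterFrame (v : ℕ → MulMod A X) : Prop :=
  (∃ x : ℕ → X, IsFrame A x ∧ v = fun n => emb A (x n)) ∨ IsOuterFrame v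

/-- The sequence `v` is a Bessel sequence (so all its terms lie in `X`) or an outer Bessel
sequence. -/
def IsBesselOrOuterBessel (v : ℕ → MulMod A X) : Prop :=
  (∃ x : ℕ → X, IsBessel A x ∧ v = fun n => emb A (x n)) ∨ IsOuterBessel v

lemma IsBesselOrOuterBessel.summable {v : ℕ → MulMod A X} (hv : IsBesselOrOuterBessel v) (y : X) :
    Summable fun n => star (pair (v n) y) * pair (v n) y := by
  rcases hv with ⟨x, ⟨D, -, hD⟩, rfl⟩ | ⟨-, D, -, hD⟩
  · obtain ⟨s, hs, -⟩ := hD y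
    simpa only [pair_emb, star_rinner] using hs.summable
  · exact (hD y).choose_spec.1.summable

/-- The analysis operator `U : X → ℓ²(A)`, `U y = (⟪vₙ, y⟫)ₙ`, of a Bessel or outer Bessel
sequence. -/
def analysis (v : ℕ → MulMod A X) (hv : IsBesselOrOuterBessel v) : X →ₗ[ℂ] L2 A where
  toFun y := ⟨fun n => pair (v n) y, IsBesselOrOuterBessel.summable hv y⟩
  map_add' y z := L2.ext fun n => (adj (v n)).1.map_add y z
  map_smul' c y := L2.ext fun n => (adj (v n)).1.map_smul c y

/-- The analysis operator of a Bessel sequence in `X`. -/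
def analysisX (x : ℕ → X) (hx : IsBessel A x) : X →ₗ[ℂ] L2 A :=
  analysis (fun n => emb A (x n)) (Or.inl ⟨x, hx, rfl⟩)

lemma analysisX_coord (x : ℕ → X) (hx : IsBessel A x) (y : X) (n : ℕ) :
    (analysisX x hx y).coord n = rinner A (x n) y := pair_emb (x n) y

/-- The sequence `f₁, …, f_N, x₁, x₂, …`. -/
def prepend {α : Type*} {N : ℕ} (f : Fin N → α) (x : ℕ → α) (n : ℕ) : α :=
  if h : n < N then f ⟨n, h⟩ else x (n - N)

end Frames

end ModFrame

end

open ModFrame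

open Filter Topology MulOpposite

namespace ModFrame

/-! ### Order comparison in a C*-algebra without unit -/

section Comparison

variable {A : Type*} [NonUnitalCStarAlgebra A] [PartialOrder A] [StarOrderedRing A]

/-! The extension of `x` by `f` has frame operator `S = U*U + ∑ fᵢ fᵢ*`, and its series at `y` sums
to `⟪y, S y⟫`. The upper frame bound always survives a finite extension, so everything hinges on `C
⟪y, y⟫ ≤ ⟪y, S y⟫`.

If this holds, `S` has an adjointable left inverse `R` (`exists_leftInverse_of_le`), and `R S = I`
reads `I - (R U*) U = ∑ (R fᵢ) fᵢ*`. So `V = U R*` works, with remainder `∑ θ_{R fᵢ, fᵢ}`.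
Conversely, if `y = V*U y + ∑ vᵢ ⟪wᵢ, y⟫`, then bounding `⟪y, y⟫` by the two summands shows that
adjoining the `wᵢ` gives a lower bound.

Two facts carry the argument over any `A`. The inequality `⟪T x, T x⟫ ≤ ‖T‖² ⟪x, x⟫`
(`rinner_apply_self_le`) is drawn from norm estimates by comparing positive elements through their
conjugates (`le_of_forall_norm_conjugate_le`). The analysis operator is adjointable, its adjoint
being the synthesis operator (`exists_BOp_eq_analysis`). Both parts of the theorem then follow from
the same two statements about multipliers, as `X` embeds in `M(X)`. -/

lemma le_of_norm_conjugate_rpow_le_one {B : Type*} [CStarAlgebra B] [PartialOrder B]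
    [StarOrderedRing B] {p b : B} (hp : 0 ≤ p) (hb : IsStrictlyPositive b)
    (h : ‖b ^ (-(1 / 2) : ℝ) * p * b ^ (-(1 / 2) : ℝ)‖ ≤ 1) : p ≤ b := by
  rw [le_iff_norm_sqrt_mul_rpow p b hp hb, ← sq_le_one_iff₀ (norm_nonneg _), sq,
    ← CStarRing.norm_star_mul_self, star_mul, (IsSelfAdjoint.of_nonneg (CFC.sqrt_nonneg p)).star_eq,
    (IsSelfAdjoint.of_nonneg CFC.rpow_nonneg).star_eq, ← mul_assoc, mul_assoc _ _ (CFC.sqrt p),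
    CFC.sqrt_mul_sqrt_self p hp]
  exact h

/-- The C*-identity gives `‖e‖⁴ = ‖e⁴‖ ≤ ‖e³‖ ‖e‖ ≤ ‖e‖³`. -/
lemma norm_le_one_of_norm_cube_le {B : Type*} [NonUnitalNormedRing B] [StarRing B] [CStarRing B]
    {e : B} (he : IsSelfAdjoint e) (h : ‖e * e * e‖ ≤ ‖e‖ * ‖e‖) : ‖e‖ ≤ 1 := by
  have h6 : ‖e * e‖ = ‖e‖ * ‖e‖ := by
    have := CStarRing.norm_star_mul_self (x := e)
    rwa [he.star_eq] at this
  have h7 : ‖e * e * (e * e)‖ = ‖e * e‖ * ‖e * e‖ := by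
    have := CStarRing.norm_star_mul_self (x := e * e)
    rwa [star_mul, he.star_eq] at this
  have h8 : ‖e * e * (e * e)‖ ≤ ‖e * e * e‖ * ‖e‖ := by
    rw [← mul_assoc]
    exact norm_mul_le _ _
  rw [h7, h6] at h8
  by_contra! hlt
  have h9 : ‖e * e * e‖ * ‖e‖ ≤ ‖e‖ * ‖e‖ * ‖e‖ := by gcongr
  have h10 : 0 < ‖e‖ * ‖e‖ * ‖e‖ := by positivity
  nlinarith

-- Put `b = q + ε`, `r = b^(-1/2)` and `e = r p r`; the goal is `‖e‖ ≤ 1`. Testing the hypothesis on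
-- `c = r e` gives `c* p c = e³` and `c* q c ≤ c* b c = e²`, hence `‖e³‖ ≤ ‖e‖²`.
open Unitization in
lemma inr_le_add_algebraMap_of_forall_norm_conjugate_le {p q : A} (hp : 0 ≤ p) (hq : 0 ≤ q)
    (h : ∀ c : A, ‖star c * p * c‖ ≤ ‖star c * q * c‖) {ε : ℝ} (hε : 0 < ε) :
    (p : Unitization ℂ A) ≤ (q : Unitization ℂ A) + algebraMap ℝ (Unitization ℂ A) ε := by
  have hpU : 0 ≤ (p : Unitization ℂ A) := inr_nonneg_iff.mpr hp
  have hqU : 0 ≤ (q : Unitization ℂ A) := inr_nonneg_iff.mpr hq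
  have hεU : IsStrictlyPositive (algebraMap ℝ (Unitization ℂ A) ε) :=
    isStrictlyPositive_algebraMap hε
  generalize hb : (q : Unitization ℂ A) + algebraMap ℝ (Unitization ℂ A) ε = b
  have hqb : (q : Unitization ℂ A) ≤ b := hb ▸ le_add_of_nonneg_right hεU.nonneg
  have hbpos : IsStrictlyPositive b := hb ▸ IsStrictlyPositive.nonneg_add hqU hεU
  refine le_of_norm_conjugate_rpow_le_one hpU hbpos ?_
  have hrbr := CFC.conjugate_rpow_neg_one_half b hbpos
  have hr0 : 0 ≤ b ^ (-(1 / 2) : ℝ) := CFC.rpow_nonneg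
  generalize b ^ (-(1 / 2) : ℝ) = r at hrbr hr0 ⊢
  have hrs : star r = r := (IsSelfAdjoint.of_nonneg hr0).star_eq
  have he0 : 0 ≤ r * p * r := conjugate_nonneg_of_nonneg hpU hr0
  have hesa : IsSelfAdjoint (r * p * r) := .of_nonneg he0
  refine norm_le_one_of_norm_cube_le hesa ?_
  -- `A` is an ideal of its unitization, so `r e` lies in `A` although `r` need not.
  have hfst : (r * (r * p * r)).fst = 0 := by simp
  generalize he : r * p * r = e at hesa hfst ⊢
  have hes : star e = e := hesa.star_eq
  obtain ⟨c, hc⟩ : ∃ c : A, (c : Unitization ℂ A) = r * e :=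
    ⟨(r * e).snd, Unitization.ext (by rw [hfst, fst_inr]) (by rw [snd_inr])⟩
  have h1 : ((star c * p * c : A) : Unitization ℂ A) = e * e * e := by
    rw [inr_mul, inr_mul, inr_star, hc, star_mul, hrs, hes]
    simp only [← he, mul_assoc]
  have h2 : ((star c * q * c : A) : Unitization ℂ A) ≤ e * e := by
    rw [inr_mul, inr_mul, inr_star, hc]
    refine (star_left_conjugate_le_conjugate hqb (r * e)).trans_eq ?_
    rw [star_mul, hrs, hes]
    calc e * r * b * (r * e) = e * (r * b * r) * e := by simp only [mul_assoc]
      _ = e * e := by rw [hrbr, mul_one]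
  rw [← h1, norm_inr]
  refine (h c).trans ?_
  rw [← norm_inr (𝕜 := ℂ)]
  refine (CStarAlgebra.norm_le_norm_of_nonneg_of_le ?_ h2).trans (norm_mul_le _ _)
  exact inr_nonneg_iff.mpr (star_left_conjugate_nonneg hq c)

/-- Positive elements of a C*-algebra can be compared through the norms of their conjugates. -/
theorem le_of_forall_norm_conjugate_le {p q : A} (hp : 0 ≤ p) (hq : 0 ≤ q)
    (h : ∀ c : A, ‖star c * p * c‖ ≤ ‖star c * q * c‖) : p ≤ q := by
  rw [← Unitization.inr_le_iff p q (.of_nonneg hp) (.of_nonneg hq)]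
  have hlim : Tendsto (fun ε : ℝ => (q : Unitization ℂ A) + algebraMap ℝ (Unitization ℂ A) ε)
      (𝓝[>] 0) (𝓝 (q : Unitization ℂ A)) := by
    have : Continuous fun ε : ℝ =>
        (q : Unitization ℂ A) + algebraMap ℝ (Unitization ℂ A) ε :=
      continuous_const.add (algebraMapCLM ℝ (Unitization ℂ A)).continuous
    simpa using (this.tendsto 0).mono_left nhdsWithin_le_nhds
  exact ge_of_tendsto hlim (eventually_mem_nhdsWithin.mono fun ε hε =>
    inr_le_add_algebraMap_of_forall_norm_conjugate_le hp hq h hε)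

end Comparison

/-! ### Adjointable operators: positivity estimates and inversion -/

section Operators

variable {A X Y : Type*} [NonUnitalCStarAlgebra A] [PartialOrder A] [StarOrderedRing A]
  [NormedAddCommGroup X] [NormedSpace ℂ X] [SMul Aᵐᵒᵖ X] [CStarModule Aᵐᵒᵖ X]
  [NormedAddCommGroup Y] [NormedSpace ℂ Y] [SMul Aᵐᵒᵖ Y] [CStarModule Aᵐᵒᵖ Y]

lemma rinner_self_nonneg (x : X) : 0 ≤ rinner A x x :=
  CStarModule.inner_self_nonneg (A := Aᵐᵒᵖ) (x := x)

lemma rinner_sub_right (x y z : X) : rinner A x (y - z) = rinner A x y - rinner A x z :=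
  map_sub (rinnerCLM A x) y z

lemma rinner_sub_left (x y z : X) : rinner A (x - y) z = rinner A x z - rinner A y z := by
  rw [← star_rinner, rinner_sub_right, star_sub, star_rinner, star_rinner]

lemma rinner_sum_right {ι : Type*} (s : Finset ι) (x : X) (y : ι → X) :
    rinner A x (∑ i ∈ s, y i) = ∑ i ∈ s, rinner A x (y i) :=
  map_sum (rinnerCLM A x) y s

lemma rinner_zero_left (x : X) : rinner A 0 x = 0 := by simp [rinner]

lemma norm_rinner_le (x y : X) : ‖rinner A x y‖ ≤ ‖x‖ * ‖y‖ := by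
  have := CStarModule.norm_inner_le (A := Aᵐᵒᵖ) X (x := x) (y := y)
  rwa [← norm_unop] at this

lemma rinner_add_self_le (x y : X) :
    rinner A (x + y) (x + y) ≤ (2 : ℝ) • (rinner A x x + rinner A y y) := by
  have h := rinner_self_nonneg (A := A) (x - y)
  rw [← sub_nonneg]
  refine h.trans_eq ?_
  simp only [rinner_add_right, rinner_add_left, rinner_sub_right, rinner_sub_left, two_smul]
  abel

lemma BOp.map_act (T : BOp A X Y) (x : X) (a : A) : T.1 (op a • x) = op a • T.1 x := by
  refine ext_rinner (A := A) fun z => ?_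
  rw [rinner_smul_right, ← star_rinner, rinner_adj, star_rinner, rinner_smul_right,
    ← star_rinner, ← rinner_adj, star_rinner]

lemma adj_adj (T : BOp A X Y) (x : X) : (adj (adj T)).1 x = T.1 x :=
  eq_adj _ fun z => by rw [← star_rinner, ← rinner_adj, star_rinner]

lemma adj_comp {Z : Type*} [NormedAddCommGroup Z] [NormedSpace ℂ Z] [SMul Aᵐᵒᵖ Z]
    [CStarModule Aᵐᵒᵖ Z] (S : BOp A Y Z) (T : BOp A X Y) (z : Z) :
    (adj (comp S T)).1 z = (adj T).1 ((adj S).1 z) :=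
  eq_adj _ fun x => by simp [comp, rinner_adj]

/-- Adjointable operators satisfy `⟪T x, T x⟫ ≤ ‖T‖² ⟪x, x⟫`. -/
theorem rinner_apply_self_le (T : BOp A X Y) (x : X) :
    rinner A (T.1 x) (T.1 x) ≤ ‖T.1‖ ^ 2 • rinner A x x := by
  -- Conjugation by `c` replaces `x` by `x c`, so only the scalar bound `‖T (x c)‖ ≤ ‖T‖ ‖x c‖` is
  -- needed.
  refine le_of_forall_norm_conjugate_le (rinner_self_nonneg _)
    (smul_nonneg (by positivity) (rinner_self_nonneg _)) fun c => ?_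
  have h1 : star c * rinner A (T.1 x) (T.1 x) * c =
      rinner A (T.1 (op c • x)) (T.1 (op c • x)) := by
    rw [BOp.map_act, rinner_smul_right, rinner_smul_left]
  have h2 : star c * (‖T.1‖ ^ 2 • rinner A x x) * c =
      ‖T.1‖ ^ 2 • rinner A (op c • x) (op c • x) := by
    rw [rinner_smul_right, rinner_smul_left, mul_smul_comm, smul_mul_assoc]
  rw [h1, h2, norm_smul, ← norm_sq_rinner, ← norm_sq_rinner, Real.norm_of_nonneg (by positivity),
    ← mul_pow]
  gcongr
  exact T.1.le_opNorm _

/-- A sum of finitely many adjointable operators is bounded on the direct sum of their domains. -/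
lemma exists_rinner_sum_apply_le {ι : Type*} (s : Finset ι) (T : ι → BOp A Y X) :
    ∃ K : ℝ, 0 < K ∧ ∀ y : ι → Y,
      rinner A (∑ i ∈ s, (T i).1 (y i)) (∑ i ∈ s, (T i).1 (y i)) ≤
        K • ∑ i ∈ s, rinner A (y i) (y i) := by
  classical
  induction s using Finset.induction_on with
  | empty => exact ⟨1, one_pos, fun y => by simp [rinner_zero_left]⟩
  | insert j s hj ih =>
    obtain ⟨K, hK, h⟩ := ih
    -- The factor 2 is the price of splitting off one summand; adding the two constants dominates
    -- both.
    refine ⟨2 * (‖(T j).1‖ ^ 2 + K), by positivity, fun y => ?_⟩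
    simp only [Finset.sum_insert hj]
    refine (rinner_add_self_le _ _).trans ?_
    rw [mul_smul]
    refine smul_le_smul_of_nonneg_left ?_ zero_le_two
    rw [smul_add]
    refine add_le_add ((rinner_apply_self_le _ _).trans ?_) ((h y).trans ?_)
    · exact smul_le_smul_of_nonneg_right (by linarith) (rinner_self_nonneg _)
    · exact smul_le_smul_of_nonneg_right (by linarith [sq_nonneg ‖(T j).1‖])
        (Finset.sum_nonneg fun i _ => rinner_self_nonneg _)

/-- A self-adjoint operator that is bounded below by a positive constant is invertible. -/
theorem exists_leftInverse_of_le [CompleteSpace X] (S : BOp A X X)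
    (hS : ∀ x y, rinner A (S.1 x) y = rinner A x (S.1 y)) {C : ℝ} (hC : 0 < C)
    (hle : ∀ y, C • rinner A y y ≤ rinner A y (S.1 y)) :
    ∃ R : BOp A X X, ∀ y, R.1 (S.1 y) = y := by
  -- The summand `C ^ 2` makes `K` positive even if `S = 0`, and ensures `C ^ 2 / K ≤ 1`.
  set K : ℝ := ‖S.1‖ ^ 2 + C ^ 2 with hK
  have hKpos : 0 < K := by positivity
  -- This minimises `1 - 2 t C + t² K`, the bound for `‖1 - t S‖²`. The minimum `1 - C² / K` is
  -- below 1, so `t S` is invertible by a Neumann series.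
  set t : ℝ := C / K with ht
  set T : X →L[ℂ] X := 1 - (t : ℂ) • S.1 with hT
  have hTapp : ∀ y, T y = y - (t : ℂ) • S.1 y := fun y => rfl
  have hb0 : 0 ≤ 1 - C ^ 2 / K := by
    rw [sub_nonneg, div_le_one hKpos]
    linarith [sq_nonneg ‖S.1‖]
  have hbd : ∀ y, rinner A (T y) (T y) ≤ (1 - C ^ 2 / K) • rinner A y y := by
    intro y
    have e1 : rinner A (T y) (T y) = rinner A y y - (2 * t) • rinner A y (S.1 y) +
        (t ^ 2) • rinner A (S.1 y) (S.1 y) := by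
      rw [hTapp]
      simp only [rinner_sub_left, rinner_sub_right, rinner_smul_complex,
        rinner_smul_complex_left, hS, Complex.star_def, Complex.conj_ofReal]
      simp only [Complex.coe_smul]
      module
    have h1 : (2 * t) • C • rinner A y y ≤ (2 * t) • rinner A y (S.1 y) :=
      smul_le_smul_of_nonneg_left (hle y) (by positivity)
    have h2 : (t ^ 2) • rinner A (S.1 y) (S.1 y) ≤ (t ^ 2) • K • rinner A y y := by
      refine smul_le_smul_of_nonneg_left ((rinner_apply_self_le S y).trans ?_) (by positivity)
      exact smul_le_smul_of_nonneg_right (by rw [hK]; linarith [sq_nonneg C])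
        (rinner_self_nonneg _)
    rw [e1]
    refine (add_le_add (sub_le_sub_left h1 _) h2).trans_eq ?_
    rw [smul_smul, smul_smul]
    have e2 : 2 * t * C = 2 * (C ^ 2 / K) := by rw [ht]; ring
    have e3 : t ^ 2 * K = C ^ 2 / K := by rw [ht]; field_simp
    rw [e2, e3]
    module
  have hnorm : ‖T‖ < 1 := by
    have h1 : ‖T‖ ≤ √(1 - C ^ 2 / K) := by
      refine T.opNorm_le_bound (Real.sqrt_nonneg _) fun y => ?_
      refine (pow_le_pow_iff_left₀ (norm_nonneg _) (by positivity) two_ne_zero).mp ?_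
      rw [mul_pow, Real.sq_sqrt hb0, norm_sq_rinner A, norm_sq_rinner A]
      refine (CStarAlgebra.norm_le_norm_of_nonneg_of_le (rinner_self_nonneg _) (hbd y)).trans ?_
      rw [norm_smul, Real.norm_of_nonneg hb0]
    refine h1.trans_lt ?_
    rw [Real.sqrt_lt' one_pos]
    have : 0 < C ^ 2 / K := by positivity
    linarith
  obtain ⟨u, hu⟩ := isUnit_one_sub_of_norm_lt_one hnorm
  have hu' : (u : X →L[ℂ] X) = (t : ℂ) • S.1 := by rw [hu, hT, sub_sub_cancel]
  set R : X →L[ℂ] X := (t : ℂ) • (↑u⁻¹ : X →L[ℂ] X) with hR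
  have hRS : ∀ y, R (S.1 y) = y := fun y => by
    have := congrArg (fun L : X →L[ℂ] X => L y) u.inv_mul
    rw [hu'] at this
    simpa [hR] using this
  have hSR : ∀ y, S.1 (R y) = y := fun y => by
    have := congrArg (fun L : X →L[ℂ] X => L y) u.mul_inv
    rw [hu'] at this
    simpa [hR] using this
  -- The inverse of a self-adjoint operator is its own adjoint.
  refine ⟨⟨R, R, fun x y => ?_⟩, hRS⟩
  conv_lhs => rw [← hSR y]
  rw [← hS, hSR]

end Operators
-- Multipliers, and adjointability of the analysis operator
section Analysis

variable {A X Y : Type*} [NonUnitalCStarAlgebra A] [PartialOrder A] [StarOrderedRing A]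
  [NormedAddCommGroup X] [NormedSpace ℂ X] [SMul Aᵐᵒᵖ X] [CStarModule Aᵐᵒᵖ X]
  [NormedAddCommGroup Y] [NormedSpace ℂ Y] [SMul Aᵐᵒᵖ Y] [CStarModule Aᵐᵒᵖ Y]

/-- A bounded operator with a formal adjoint is adjointable. -/
lemma mem_BOp_of_formal_adjoint (T : X →L[ℂ] Y) (g : Y → X)
    (h : ∀ x y, rinner A (T x) y = rinner A x (g y)) : T ∈ BOp A X Y := by
  refine ⟨LinearMap.mkContinuous
    { toFun := g
      map_add' := fun y z => ext_rinner (A := A) fun x => by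
        simp only [rinner_add_right, ← h]
      map_smul' := fun c y => ext_rinner (A := A) fun x => by
        simp only [rinner_smul_complex, ← h, RingHom.id_apply] } ‖T‖ fun y => ?_, h⟩
  change ‖g y‖ ≤ ‖T‖ * ‖y‖
  rcases (norm_nonneg (g y)).eq_or_lt with h0 | h0
  · rw [← h0]; positivity
  refine le_of_mul_le_mul_left ?_ h0
  calc ‖g y‖ * ‖g y‖ = ‖rinner A (g y) (g y)‖ := by rw [← norm_sq_rinner, sq]
    _ = ‖rinner A (T (g y)) y‖ := by rw [h]
    _ ≤ ‖T (g y)‖ * ‖y‖ := norm_rinner_le _ _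
    _ ≤ ‖T‖ * ‖g y‖ * ‖y‖ := by gcongr; exact T.le_opNorm _
    _ = ‖g y‖ * (‖T‖ * ‖y‖) := by ring

lemma emb_injective : Function.Injective (emb A (X := X)) := by
  intro x y h
  have h1 : ∀ a : A, op a • x = op a • y := fun a => congrArg (fun v : MulMod A X => v.1 a) h
  refine ext_rinner (A := A) fun z => ?_
  have h2 : ∀ a : A, (rinner A z x - rinner A z y) * a = 0 := fun a => by
    rw [sub_mul, ← rinner_smul_right, ← rinner_smul_right, h1, sub_self]
  rw [← sub_eq_zero]
  -- Here `a` is the adjoint of the difference itself.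
  exact (CStarRing.mul_star_self_eq_zero_iff _).mp (h2 _)

lemma act_emb (v : MulMod A X) (a : A) : act v (emb A a) = emb A (v.1 a) :=
  Subtype.ext <| ContinuousLinearMap.ext fun b => BOp.map_act v a b

lemma mtheta_emb (v w : MulMod A X) (y : X) :
    mtheta v w (emb A y) = emb A (v.1 (pair w y)) := by
  change act v (minner w (emb A y)) = _
  rw [minner_emb, act_emb]

lemma pair_eq_adj (v : MulMod A X) (y : X) : pair v y = (adj v).1 y := rfl

lemma rinner_mulMod_apply (v : MulMod A X) (y : X) (a : A) :
    rinner A y (v.1 a) = star (pair v y) * a := by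
  rw [← star_rinner, rinner_adj, ← pair_eq_adj, star_rinner, rinner_self_def]

lemma analysis_coord (v : ℕ → MulMod A X) (hv : IsBesselOrOuterBessel v) (y : X) (n : ℕ) :
    (analysis v hv y).coord n = pair (v n) y := rfl

lemma hasSum_analysis (v : ℕ → MulMod A X) (hv : IsBesselOrOuterBessel v) (y : X) :
    HasSum (fun n => star (pair (v n) y) * pair (v n) y)
      (rinner A (analysis v hv y) (analysis v hv y)) :=
  (hv.summable y).hasSum

lemma exists_rinner_analysis_le (v : ℕ → MulMod A X) (hv : IsBesselOrOuterBessel v) :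
    ∃ D : ℝ, 0 < D ∧ ∀ y,
      rinner A (analysis v hv y) (analysis v hv y) ≤ D • rinner A y y := by
  have hv' := hv
  rcases hv' with ⟨x, ⟨D, hD, h⟩, rfl⟩ | ⟨-, D, hD, h⟩ <;> refine ⟨D, hD, fun y => ?_⟩ <;>
    obtain ⟨s, hs, hle⟩ := h y
  · have hs' : HasSum (fun n => star (pair (emb A (x n)) y) * pair (emb A (x n)) y) s := by
      simpa only [pair_emb, star_rinner] using hs
    rwa [(hasSum_analysis _ hv y).unique hs']
  · rwa [(hasSum_analysis _ hv y).unique hs]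

/-- The restriction of a sequence in `ℓ²(A)` to a finite set of indices. -/
noncomputable def L2.restrict (a : L2 A) (F : Finset ℕ) : L2 A :=
  ⟨fun n => open Classical in if n ∈ F then a.coord n else 0,
    summable_of_ne_finset_zero (s := F) fun n hn => by simp [hn]⟩

lemma L2.rinner_restrict (a b : L2 A) (F : Finset ℕ) :
    rinner A b (a.restrict F) = ∑ n ∈ F, star (b.coord n) * a.coord n := by
  rw [L2.rinner_def, tsum_eq_sum (s := F) fun n hn => by simp [L2.restrict, L2.coord, hn]]
  exact Finset.sum_congr rfl fun n hn => by simp [L2.restrict, L2.coord, hn]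

lemma L2.norm_sq_restrict (a : L2 A) (F : Finset ℕ) :
    ‖a.restrict F‖ ^ 2 = ‖∑ n ∈ F, star (a.coord n) * a.coord n‖ := by
  rw [norm_sq_rinner A, L2.rinner_restrict]
  exact congrArg _ (Finset.sum_congr rfl fun n hn => by simp [L2.restrict, L2.coord, hn])

lemma norm_analysis_le {v : ℕ → MulMod A X} {hv : IsBesselOrOuterBessel v} {D : ℝ} (hD : 0 < D)
    (h : ∀ y, rinner A (analysis v hv y) (analysis v hv y) ≤ D • rinner A y y) (y : X) :
    ‖analysis v hv y‖ ≤ √D * ‖y‖ := by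
  refine (pow_le_pow_iff_left₀ (norm_nonneg _) (by positivity) two_ne_zero).mp ?_
  rw [mul_pow, Real.sq_sqrt hD.le, norm_sq_rinner A, norm_sq_rinner A]
  refine (CStarAlgebra.norm_le_norm_of_nonneg_of_le (rinner_self_nonneg _) (h y)).trans ?_
  rw [norm_smul, Real.norm_of_nonneg hD.le]

/-- Duality: the finite sum `z` satisfies `⟪z, z⟫ = ⟪U z, a|_F⟫`, and Cauchy–Schwarz with `‖U z‖ ≤
√D ‖z‖` lets one factor `‖z‖` cancel. This yields the Cauchy criterion for the synthesis series. -/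
lemma norm_sum_apply_le {v : ℕ → MulMod A X} {hv : IsBesselOrOuterBessel v} {D : ℝ} (hD : 0 < D)
    (h : ∀ y, rinner A (analysis v hv y) (analysis v hv y) ≤ D • rinner A y y) (a : L2 A)
    (F : Finset ℕ) : ‖∑ n ∈ F, (v n).1 (a.coord n)‖ ≤ √D * ‖a.restrict F‖ := by
  set z := ∑ n ∈ F, (v n).1 (a.coord n) with hz
  have h1 : rinner A z z = rinner A (analysis v hv z) (a.restrict F) := by
    rw [L2.rinner_restrict]
    conv_lhs => rw [hz, rinner_sum_right, ← hz]
    simp only [rinner_mulMod_apply, analysis_coord]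
  rcases (norm_nonneg z).eq_or_lt with h0 | h0
  · rw [← h0]; positivity
  refine le_of_mul_le_mul_left ?_ h0
  calc ‖z‖ * ‖z‖ = ‖rinner A (analysis v hv z) (a.restrict F)‖ := by
        rw [← h1, ← norm_sq_rinner, sq]
    _ ≤ ‖analysis v hv z‖ * ‖a.restrict F‖ := norm_rinner_le _ _
    _ ≤ √D * ‖z‖ * ‖a.restrict F‖ := by gcongr; exact norm_analysis_le hD h z
    _ = ‖z‖ * (√D * ‖a.restrict F‖) := by ring

lemma summable_apply [CompleteSpace X] {v : ℕ → MulMod A X} (hv : IsBesselOrOuterBessel v)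
    (a : L2 A) : Summable fun n => (v n).1 (a.coord n) := by
  obtain ⟨D, hD, h⟩ := exists_rinner_analysis_le v hv
  have ha := a.summable_self
  rw [summable_iff_vanishing_norm] at ha ⊢
  intro ε hε
  obtain ⟨s, hs⟩ := ha (ε ^ 2 / D) (by positivity)
  refine ⟨s, fun t ht => ?_⟩
  refine (pow_lt_pow_iff_left₀ (norm_nonneg _) hε.le two_ne_zero).mp ?_
  have h1 := norm_sum_apply_le hD h a t
  calc ‖∑ n ∈ t, (v n).1 (a.coord n)‖ ^ 2 ≤ (√D * ‖a.restrict t‖) ^ 2 := by gcongr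
    _ = D * ‖∑ n ∈ t, star (a.coord n) * a.coord n‖ := by
      rw [mul_pow, Real.sq_sqrt hD.le, L2.norm_sq_restrict]
    _ < D * (ε ^ 2 / D) := by gcongr; exact hs t ht
    _ = ε ^ 2 := by field_simp

/-- The analysis operator of a Bessel or outer Bessel sequence is adjointable. -/
theorem exists_BOp_eq_analysis [CompleteSpace X] (v : ℕ → MulMod A X)
    (hv : IsBesselOrOuterBessel v) :
    ∃ U : BOp A X (L2 A), ∀ y, U.1 y = analysis v hv y := by
  obtain ⟨D, hD, h⟩ := exists_rinner_analysis_le v hv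
  -- The adjoint is the synthesis operator `a ↦ ∑ vₙ(aₙ)`.
  refine ⟨⟨(analysis v hv).mkContinuous (√D) (norm_analysis_le hD h),
    mem_BOp_of_formal_adjoint _ (fun a => ∑' n, (v n).1 (a.coord n)) fun y a => ?_⟩,
    fun y => rfl⟩
  change rinner A (analysis v hv y) a = _
  have h1 := (rinnerCLM A y).map_tsum (summable_apply hv a)
  refine Eq.trans ?_ h1.symm
  rw [L2.rinner_def]
  exact tsum_congr fun n => (rinner_mulMod_apply (v n) y _).symm

end Analysis

/-! ### Finite extensions and left inverses modulo finite rank -/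

section Extension

variable {A X : Type*} [NonUnitalCStarAlgebra A] [PartialOrder A] [StarOrderedRing A]
  [NormedAddCommGroup X] [NormedSpace ℂ X] [SMul Aᵐᵒᵖ X] [CStarModule Aᵐᵒᵖ X]

/-- The frame inequalities for a sequence of multipliers. -/
def HasFrameBounds (v : ℕ → MulMod A X) : Prop :=
  ∃ C D : ℝ, 0 < C ∧ 0 < D ∧ ∀ y : X, ∃ s : A,
    HasSum (fun n => star (pair (v n) y) * pair (v n) y) s ∧
    C • rinner A y y ≤ s ∧ s ≤ D • rinner A y y

lemma isFrame_iff_hasFrameBounds (x : ℕ → X) :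
    IsFrame A x ↔ HasFrameBounds fun n => emb A (x n) := by
  simp only [IsFrame, HasFrameBounds, pair_emb, star_rinner]

/-- Either some term lies outside `X` or all terms lie in `X`, so where the terms lie imposes no
condition. -/
lemma isFrameOrOuterFrame_iff_hasFrameBounds (v : ℕ → MulMod A X) :
    IsFrameOrOuterFrame v ↔ HasFrameBounds v := by
  constructor
  · rintro (⟨x, hx, rfl⟩ | ⟨-, h⟩)
    · exact (isFrame_iff_hasFrameBounds x).mp hx
    · exact h
  · intro h
    by_cases hv : ∃ n, v n ∉ Set.range (emb A (X := X))
    · exact Or.inr ⟨hv, h⟩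
    · push Not at hv
      choose x hx using hv
      obtain rfl : (fun n => emb A (x n)) = v := funext hx
      exact Or.inl ⟨x, (isFrame_iff_hasFrameBounds x).mpr h, rfl⟩

lemma emb_prepend {N : ℕ} (f : Fin N → X) (x : ℕ → X) :
    (fun n => emb A (prepend f x n)) = prepend (fun i => emb A (f i)) fun n => emb A (x n) := by
  funext n
  unfold prepend
  split_ifs <;> rfl

lemma hasSum_prepend {N : ℕ} (f : Fin N → MulMod A X) (x : ℕ → MulMod A X)
    (hx : IsBesselOrOuterBessel x) (y : X) :
    HasSum (fun n => star (pair (prepend f x n) y) * pair (prepend f x n) y)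
      (rinner A (analysis x hx y) (analysis x hx y) +
        ∑ i, star (pair (f i) y) * pair (f i) y) := by
  have h := hasSum_analysis x hx y
  rw [show (∑ i, star (pair (f i) y) * pair (f i) y) = ∑ n ∈ Finset.range N,
      star (pair (prepend f x n) y) * pair (prepend f x n) y by
    rw [Finset.sum_range]
    exact Finset.sum_congr rfl fun i _ => by simp [prepend]]
  rw [← hasSum_nat_add_iff]
  simpa [prepend] using h

lemma hasFrameBounds_prepend_iff {N : ℕ} (f : Fin N → MulMod A X) (x : ℕ → MulMod A X)
    (hx : IsBesselOrOuterBessel x) :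
    HasFrameBounds (prepend f x) ↔ ∃ C : ℝ, 0 < C ∧ ∀ y : X,
      C • rinner A y y ≤ rinner A (analysis x hx y) (analysis x hx y) +
        ∑ i, star (pair (f i) y) * pair (f i) y := by
  constructor
  · rintro ⟨C, _, hC, _, h⟩
    refine ⟨C, hC, fun y => ?_⟩
    obtain ⟨s, hs, hle, -⟩ := h y
    rwa [(hasSum_prepend f x hx y).unique hs]
  · rintro ⟨C, hC, h⟩
    obtain ⟨D, hD, hU⟩ := exists_rinner_analysis_le x hx
    -- Each added term contributes at most `‖fᵢ*‖² ⟪y, y⟫` to the Bessel bound.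
    refine ⟨C, D + ∑ i, ‖(adj (f i)).1‖ ^ 2, hC, by positivity, fun y =>
      ⟨_, hasSum_prepend f x hx y, h y, ?_⟩⟩
    rw [add_smul, Finset.sum_smul]
    exact add_le_add (hU y) (Finset.sum_le_sum fun i _ => rinner_apply_self_le (adj (f i)) y)

/-- A finite extension satisfying the frame inequalities yields a left inverse modulo finite rank
of the original analysis operator. -/
theorem HasFrameBounds.exists_leftInverse [CompleteSpace X] {N : ℕ} {f : Fin N → MulMod A X}
    {x : ℕ → MulMod A X} (hx : IsBesselOrOuterBessel x) (h : HasFrameBounds (prepend f x)) :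
    ∃ (V : BOp A X (L2 A)) (R : BOp A X X), ∀ y,
      y - (adj V).1 (analysis x hx y) = ∑ i, R.1 ((f i).1 (pair (f i) y)) := by
  obtain ⟨C, hC, hle⟩ := (hasFrameBounds_prepend_iff f x hx).mp h
  obtain ⟨U, hU⟩ := exists_BOp_eq_analysis x hx
  -- The frame operator of the extended sequence.
  set S : BOp A X X := comp (adj U) U + ∑ i, comp (f i) (adj (f i)) with hS
  have hSapp : ∀ y, S.1 y = (adj U).1 (U.1 y) + ∑ i, (f i).1 (pair (f i) y) := fun y => by
    simp [hS, comp, pair_eq_adj]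
  have hSr : ∀ y z, rinner A y (S.1 z) =
      rinner A (U.1 y) (U.1 z) + ∑ i, star (pair (f i) y) * pair (f i) z := fun y z => by
    rw [hSapp, rinner_add_right, rinner_sum_right, rinner_adj]
    simp only [rinner_mulMod_apply]
  obtain ⟨R, hR⟩ := exists_leftInverse_of_le S (fun y z => by
    rw [← star_rinner, hSr, hSr]
    simp [star_rinner]) hC fun y => by rw [hSr, hU]; exact hle y
  -- With `V = U R*` one has `V* = R U*`, and the identity is `R S = I` rearranged.
  refine ⟨comp U (adj R), R, fun y => ?_⟩
  have h1 := hR y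
  rw [hSapp, map_add, map_sum] at h1
  rw [adj_comp, adj_adj, ← hU]
  exact sub_eq_of_eq_add' h1.symm

/-- A left inverse modulo finite rank of the analysis operator yields a finite extension
satisfying the frame inequalities. -/
theorem hasFrameBounds_prepend_of_leftInverse {N : ℕ} {v w : Fin N → MulMod A X}
    {x : ℕ → MulMod A X} (hx : IsBesselOrOuterBessel x) (V : BOp A X (L2 A))
    (h : ∀ y, y - (adj V).1 (analysis x hx y) = ∑ i, (v i).1 (pair (w i) y)) :
    HasFrameBounds (prepend w x) := by
  rw [hasFrameBounds_prepend_iff w x hx]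
  obtain ⟨K, hK, hv⟩ := exists_rinner_sum_apply_le Finset.univ v
  -- `‖V*‖²` controls the part of `y` recovered from `U y`, `K` the finite rank part; the lower
  -- frame bound is `L⁻¹`.
  set L : ℝ := 2 * (‖(adj V).1‖ ^ 2 + K) with hL
  have hLpos : 0 < L := by positivity
  refine ⟨L⁻¹, by positivity, fun y => ?_⟩
  rw [inv_smul_le_iff_of_pos hLpos]
  have hy : y = (adj V).1 (analysis x hx y) + ∑ i, (v i).1 (pair (w i) y) := by
    rw [← h, add_sub_cancel]
  conv_lhs => rw [hy]
  refine (rinner_add_self_le _ _).trans ?_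
  rw [hL, mul_smul]
  refine smul_le_smul_of_nonneg_left ?_ zero_le_two
  rw [smul_add]
  refine add_le_add ((rinner_apply_self_le _ _).trans ?_) ((hv fun i => pair (w i) y).trans ?_)
  · exact smul_le_smul_of_nonneg_right (by linarith) (rinner_self_nonneg _)
  · exact smul_le_smul_of_nonneg_right (by linarith [sq_nonneg ‖(adj V).1‖])
      (Finset.sum_nonneg fun i _ => star_mul_self_nonneg _)

lemma exists_eq_sum_of_mem_MFinRank {θ : MulMod A X →ₗ[ℂ] MulMod A X} (hθ : θ ∈ MFinRank A X) :
    ∃ (N : ℕ) (v w : Fin N → MulMod A X), ∀ y : X,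
      θ (emb A y) = emb A (∑ i, (v i).1 (pair (w i) y)) := by
  obtain ⟨N, c, g, rfl⟩ := (Submodule.mem_span_set' ..).mp hθ
  choose p hp using fun i => (g i).2
  -- The scalars go into the left vector, in which `θ` is linear rather than conjugate-linear.
  refine ⟨N, fun i => c i • (p i).1, fun i => (p i).2, fun y => ?_⟩
  rw [LinearMap.sum_apply, map_sum]
  refine Finset.sum_congr rfl fun i _ => ?_
  rw [← hp i, LinearMap.smul_apply, mtheta_emb, ← map_smul]
  rfl

lemma exists_eq_sum_of_mem_FinRank {θ : X →ₗ[ℂ] X} (hθ : θ ∈ FinRank A X) :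
    ∃ (N : ℕ) (v w : Fin N → X), ∀ y : X,
      θ y = ∑ i, (emb A (v i)).1 (pair (emb A (w i)) y) := by
  obtain ⟨N, c, g, rfl⟩ := (Submodule.mem_span_set' ..).mp hθ
  choose p hp using fun i => (g i).2
  refine ⟨N, fun i => c i • (p i).1, fun i => (p i).2, fun y => ?_⟩
  rw [LinearMap.sum_apply]
  refine Finset.sum_congr rfl fun i _ => ?_
  rw [← hp i, LinearMap.smul_apply, map_smul, pair_emb]
  rfl

end Extension

end ModFrame

/-! ### The theorem -/

theorem theorem6p1 {A X : Type*} [NonUnitalCStarAlgebra A] [PartialOrder A] [StarOrderedRing A]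
    [NormedAddCommGroup X] [NormedSpace ℂ X] [SMul Aᵐᵒᵖ X] [CStarModule Aᵐᵒᵖ X]
    [CompleteSpace X] :
    (∀ (x : ℕ → MulMod A X) (hx : IsBesselOrOuterBessel x),
      (∃ (N : ℕ) (f : Fin N → MulMod A X), IsFrameOrOuterFrame (prepend f x)) ↔
        ∃ V : BOp A X (L2 A), ∃ θ ∈ MFinRank A X,
          ∀ y : X, emb A (y - (adj V).1 (analysis x hx y)) = θ (emb A y)) ∧
    (∀ (x : ℕ → X) (hx : IsBessel A x),
      (∃ (N : ℕ) (f : Fin N → X), IsFrame A (prepend f x)) ↔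
        ∃ V : BOp A X (L2 A),
          LinearMap.id - (adj V).1.toLinearMap ∘ₗ analysisX x hx ∈ FinRank A X) := by
  refine ⟨fun x hx => ⟨?_, ?_⟩, fun x hx => ⟨?_, ?_⟩⟩
  · rintro ⟨N, f, hf⟩
    rw [isFrameOrOuterFrame_iff_hasFrameBounds] at hf
    obtain ⟨V, R, h⟩ := hf.exists_leftInverse hx
    refine ⟨V, ∑ i, mtheta (comp R (f i)) (f i),
      Submodule.sum_mem _ fun i _ => Submodule.subset_span ⟨(_, _), rfl⟩, fun y => ?_⟩
    simp only [h, LinearMap.sum_apply, mtheta_emb, map_sum]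
    rfl
  · rintro ⟨V, θ, hθ, h⟩
    obtain ⟨N, v, w, hvw⟩ := exists_eq_sum_of_mem_MFinRank hθ
    refine ⟨N, w, (isFrameOrOuterFrame_iff_hasFrameBounds _).mpr
      (hasFrameBounds_prepend_of_leftInverse (v := v) hx V fun y => emb_injective (A := A) ?_)⟩
    rw [h, hvw]
  · rintro ⟨N, f, hf⟩
    rw [isFrame_iff_hasFrameBounds, emb_prepend] at hf
    obtain ⟨V, R, h⟩ := hf.exists_leftInverse (Or.inl ⟨x, hx, rfl⟩)
    refine ⟨V, ?_⟩
    have : LinearMap.id - (adj V).1.toLinearMap ∘ₗ analysisX x hx =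
        ∑ i, theta (A := A) (R.1 (f i)) (f i) := by
      ext y
      refine (h y).trans ?_
      rw [LinearMap.sum_apply]
      refine Finset.sum_congr rfl fun i _ => ?_
      -- `A`-linearity of `R` moves it onto `fᵢ`, so the left vectors `R fᵢ` stay in `X`.
      rw [theta_apply, ← BOp.map_act, pair_emb]
      rfl
    rw [this]
    exact Submodule.sum_mem _ fun i _ => Submodule.subset_span ⟨(_, _), rfl⟩
  · rintro ⟨V, h⟩
    obtain ⟨N, v, w, hvw⟩ := exists_eq_sum_of_mem_FinRank h
    refine ⟨N, w, ?_⟩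
    rw [isFrame_iff_hasFrameBounds, emb_prepend]
    exact hasFrameBounds_prepend_of_leftInverse (v := fun i => emb A (v i))
      (Or.inl ⟨x, hx, rfl⟩) V hvw
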